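/- Let $\Omega\subset\mathbb R^2$ be a bounded convex polygonal domain, and let $H^1_0(\Omega)^2$ be the closure of $C_0^\infty(\Omega)^2$ in the $H^1$ norm, $H^{-1}(\Omega)^2$ its dual, and $H$ the closure in $L^2(\Omega)^2$ of the divergence free fields in $C_0^\infty(\Omega)^2$. For $T>0$ put $I=(0,T]$, let $0=t_0<t_1<\dots<t_M=T$ be any partition with $I_m=(t_{m-1},t_m]$, and let $U_h\subset H^1_0(\Omega)^2$ and $M_h\subset L^2_0(\Omega)$ (the functions with zero mean) be any finite dimensional subspaces. Put $V_h=\{v\in U_h:(\nabla\cdot v,p)_\Omega=0\ \text{for all } p\in M_h\}$. For $q\in\{0,1\}$ let $V_{kh}$ be the space of functions $v:I\to V_h$ that on each $I_m$ are polynomials in time of degree at most $q$ with coefficients in $V_h$. Write $v_m^\pm$ for the one-sided limits at $t_m$, $[v]_m=v_m^+-v_m^-$, $$\mathfrak B(u,v)=\sum_{m=1}^M(\partial_tu,v)_{I_m\times\Omega}+\nu(\nabla u,\nabla v)_{I\times\Omega}+\sum_{m=2}^M([u]_{m-1},v_{m-1}^+)_\Omega+(u_0^+,v_0^+)_\Omega,$$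 and $\hat c(u,v,w)=\tfrac12((u\cdot\nabla)v,w)_\Omega-\tfrac12((u\cdot\nabla)w,v)_\Omega$. Given a viscosity $\nu>0$, $u_0\in H$ and $f\in L^1(I;L^2(\Omega)^2)+L^2(I;H^{-1}(\Omega)^2)$, a function $u_{kh}\in V_{kh}$ is called a fully discrete solution of the Navier-Stokes equations if $$\mathfrak B(u_{kh},v)+\int_I\hat c(u_{kh},u_{kh},v)\,dt=\int_I\langle f,v\rangle\,dt+(u_0,v_0^+)_\Omega\qquad\text{for all }v\in V_{kh}.$$ **Theorem.** (1) For every $\nu>0$ there is a constant $C$ depending only on $\Omega$ and $\nu$ such that for all $T$, partitions, spaces $U_h,M_h$, $q\in\{0,1\}$, $u_0\in H$ and $f\in L^1(I;L^2(\Omega)^2)+L^2(I;H^{-1}(\Omega)^2)$ every fully discrete solution $u_{kh}$ satisfies $$\|u_{kh}\|_{L^\infty(I;L^2(\Omega))}+\sqrt\nu\,\|u_{kh}\|_{L^2(I;H^1(\Omega))}\le C\left(\|u_0\|_{L^2(\Omega)}+\|f\|_{L^1(I;L^2(\Omega))+L^2(I;H^{-1}(\Omega))}\right),$$ where the norm of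 $f$ is the infimum of $\|f_1\|_{L^1(I;L^2(\Omega))}+\|f_2\|_{L^2(I;H^{-1}(\Omega))}$ over all splittings $f=f_1+f_2$. (2) There is a constant $C$ depending only on $\Omega$ such that for all $\nu>0$, all $T$, partitions, spaces $U_h,M_h$, $q\in\{0,1\}$, $u_0\in H$ and $f\in L^1(I;L^2(\Omega)^2)$ every fully discrete solution $u_{kh}$ satisfies $$\|u_{kh}\|_{L^\infty(I;L^2(\Omega))}+\sqrt\nu\,\|u_{kh}\|_{L^2(I;H^1(\Omega))}\le C\left(\|u_0\|_{L^2(\Omega)}+\|f\|_{L^1(I;L^2(\Omega))}\right).$$ In particular the bounds are linear in the data, and the constants do not depend on $T$. -/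

import Mathlib

open MeasureTheory Set Filter Topology
open scoped ENNReal NNReal ContDiff InnerProductSpace

noncomputable section

namespace NavierStokesDG

/-- The plane with its Euclidean norm. -/
abbrev Plane := EuclideanSpace ℝ (Fin 2)

/-- Real `2 × 2` arrays with the Frobenius norm; the entry `(i, j)` of a gradient is `∂ⱼ vᵢ`. -/
abbrev Arr := EuclideanSpace ℝ (Fin 2 × Fin 2)

/-- `Ω` is a convex polygonal domain: the nonempty interior of the convex hull of finitely many
points of the plane. -/
def IsConvexPolygonalDomain (Ω : Set Plane) : Prop :=
  Ω.Nonempty ∧ ∃ S : Set Plane, S.Finite ∧ Ω = interior (convexHull ℝ S)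

/-! ### Function spaces on the domain -/

/-- The scalar space `L²(Ω)`. -/
abbrev L2S (Ω : Set Plane) := Lp ℝ 2 (volume.restrict Ω)

/-- The space `L²(Ω)²` of vector fields. -/
abbrev L2V (Ω : Set Plane) := Lp Plane 2 (volume.restrict Ω)

/-- The space `L²(Ω)^{2×2}`. -/
abbrev L2M (Ω : Set Plane) := Lp Arr 2 (volume.restrict Ω)

/-- Pairs (field, gradient) with the norm `(‖v‖² + ‖G‖²)^{1/2}`, which is the `H¹` norm when
`G` is the weak gradient of `v`. -/
abbrev L2Pair (Ω : Set Plane) := WithLp 2 (L2V Ω × L2M Ω)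

/-- The classical gradient of a vector field. -/
def gradField (φ : Plane → Plane) (x : Plane) : Arr :=
  WithLp.toLp 2 fun ij => fderiv ℝ φ x (EuclideanSpace.single ij.2 1) ij.1

/-- The classical divergence of a vector field. -/
def divField (φ : Plane → Plane) (x : Plane) : ℝ := ∑ i : Fin 2, gradField φ x (i, i)

/-- `φ ∈ C₀^∞(Ω)²`: smooth vector fields with compact support in `Ω`. -/
structure IsTestField (Ω : Set Plane) (φ : Plane → Plane) : Prop where
  smooth : ContDiff ℝ ∞ φ
  compact : HasCompactSupport φ
  support : tsupport φ ⊆ Ω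

theorem isTestField_zero (Ω : Set Plane) : IsTestField Ω 0 where
  smooth := contDiff_const
  compact := HasCompactSupport.zero
  support := by simp [tsupport]

theorem IsTestField.add {Ω : Set Plane} {φ ψ : Plane → Plane} (hφ : IsTestField Ω φ)
    (hψ : IsTestField Ω ψ) : IsTestField Ω (φ + ψ) where
  smooth := hφ.smooth.add hψ.smooth
  compact := hφ.compact.add hψ.compact
  support := (tsupport_add φ ψ).trans (union_subset hφ.support hψ.support)

theorem IsTestField.smul {Ω : Set Plane} {φ : Plane → Plane} (a : ℝ) (hφ : IsTestField Ω φ) :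
    IsTestField Ω (a • φ) where
  smooth := hφ.smooth.const_smul a
  compact := hφ.compact.smul_left (f := fun _ => a)
  support := (tsupport_smul_subset_right (fun _ => a) φ).trans hφ.support

theorem gradField_zero : gradField 0 = 0 := by
  ext x ij; simp [gradField]

theorem gradField_add {Ω : Set Plane} {φ ψ : Plane → Plane} (hφ : IsTestField Ω φ)
    (hψ : IsTestField Ω ψ) : gradField (φ + ψ) = gradField φ + gradField ψ := by
  ext x ij
  simp [gradField, fderiv_add (hφ.smooth.differentiable (by simp) x)
    (hψ.smooth.differentiable (by simp) x)]

theorem gradField_smul {Ω : Set Plane} {φ : Plane → Plane} (a : ℝ) (hφ : IsTestField Ω φ) :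
    gradField (a • φ) = a • gradField φ := by
  ext x ij
  simp [gradField, fderiv_const_smul (hφ.smooth.differentiable (by simp) x) a]

/-- The pairs `(φ, ∇φ)` with `φ ∈ C₀^∞(Ω)²`. -/
def testGraph (Ω : Set Plane) : Submodule ℝ (L2Pair Ω) where
  carrier := {p | ∃ φ, IsTestField Ω φ ∧ p.fst =ᵐ[volume.restrict Ω] φ ∧
    p.snd =ᵐ[volume.restrict Ω] gradField φ}
  zero_mem' := ⟨0, isTestField_zero Ω, Lp.coeFn_zero _ _ _, by
    rw [gradField_zero]; exact Lp.coeFn_zero _ _ _⟩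
  add_mem' := by
    rintro p q ⟨φ, hφ, h1, h2⟩ ⟨ψ, hψ, h3, h4⟩
    refine ⟨φ + ψ, hφ.add hψ, (Lp.coeFn_add p.fst q.fst).trans (h1.add h3), ?_⟩
    rw [gradField_add hφ hψ]
    exact (Lp.coeFn_add p.snd q.snd).trans (h2.add h4)
  smul_mem' := by
    rintro a p ⟨φ, hφ, h1, h2⟩
    refine ⟨a • φ, hφ.smul a, (Lp.coeFn_smul a p.fst).trans (h1.const_smul a), ?_⟩
    rw [gradField_smul a hφ]
    exact (Lp.coeFn_smul a p.snd).trans (h2.const_smul a)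

/-- `H¹₀(Ω)²`, the closure of `C₀^∞(Ω)²` in the `H¹` norm. An element is stored together with its
weak gradient, and the norm is the `H¹` norm. -/
abbrev H10 (Ω : Set Plane) := (testGraph Ω).topologicalClosure

/-- The inclusion `H¹₀(Ω)² → L²(Ω)²`. -/
def toL2 (Ω : Set Plane) : H10 Ω →L[ℝ] L2V Ω :=
  (WithLp.fstL 2 ℝ (L2V Ω) (L2M Ω)).comp (H10 Ω).subtypeL

/-- The weak gradient `H¹₀(Ω)² → L²(Ω)^{2×2}`. -/
def grad (Ω : Set Plane) : H10 Ω →L[ℝ] L2M Ω :=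
  (WithLp.sndL 2 ℝ (L2V Ω) (L2M Ω)).comp (H10 Ω).subtypeL

/-- The trace of a `2 × 2` array. -/
def arrTrace : Arr →L[ℝ] ℝ := ∑ i : Fin 2, EuclideanSpace.proj (i, i)

/-- The divergence `H¹₀(Ω)² → L²(Ω)`. -/
def divergence (Ω : Set Plane) : H10 Ω →L[ℝ] L2S Ω :=
  (arrTrace.compLpL 2 (volume.restrict Ω)).comp (grad Ω)

/-- The solenoidal space `H`: the closure in `L²(Ω)²` of the divergence free fields in
`C₀^∞(Ω)²`. -/
def solenoidal (Ω : Set Plane) : Set (L2V Ω) :=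
  closure {v | ∃ φ, IsTestField Ω φ ∧ (∀ x, divField φ x = 0) ∧ v =ᵐ[volume.restrict Ω] φ}

/-- `H^{-1}(Ω)²`, the dual of `H¹₀(Ω)²` with the dual norm. -/
abbrev Hm1 (Ω : Set Plane) := StrongDual ℝ (H10 Ω)

/-- The embedding `L²(Ω)² → H^{-1}(Ω)²`, `g ↦ (g, ·)`. -/
def toHm1 {Ω : Set Plane} (g : L2V Ω) : Hm1 Ω := (innerSL ℝ g).comp (toL2 Ω)

/-! ### Bochner spaces in time -/

/-- Lebesgue measure on `I = (0, T]`. -/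
abbrev timeMeasure (T : ℝ) : Measure ℝ := volume.restrict (Ioc 0 T)

/-- `f = f₁ + f₂` with `f₁ ∈ L¹(I; L²(Ω)²)` and `f₂ ∈ L²(I; H^{-1}(Ω)²)`. -/
structure IsSplitting {Ω : Set Plane} (T : ℝ) (f : ℝ → Hm1 Ω) (f₁ : ℝ → L2V Ω)
    (f₂ : ℝ → Hm1 Ω) : Prop where
  left : MemLp f₁ 1 (timeMeasure T)
  right : MemLp f₂ 2 (timeMeasure T)
  sum_eq : f =ᵐ[timeMeasure T] fun s => toHm1 (f₁ s) + f₂ s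

/-- `f ∈ L¹(I; L²(Ω)²) + L²(I; H^{-1}(Ω)²)`. -/
def MemSum {Ω : Set Plane} (T : ℝ) (f : ℝ → Hm1 Ω) : Prop :=
  ∃ f₁ f₂, IsSplitting T f f₁ f₂

/-- The norm of `L¹(I; L²(Ω)²) + L²(I; H^{-1}(Ω)²)`: the infimum of
`‖f₁‖_{L¹(I; L²)} + ‖f₂‖_{L²(I; H^{-1})}` over all splittings. -/
def sumNorm {Ω : Set Plane} (T : ℝ) (f : ℝ → Hm1 Ω) : ℝ≥0∞ :=
  ⨅ (f₁ : ℝ → L2V Ω) (f₂ : ℝ → Hm1 Ω) (_ : IsSplitting T f f₁ f₂),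
    eLpNorm f₁ 1 (timeMeasure T) + eLpNorm f₂ 2 (timeMeasure T)

/-! ### Space discretization -/

/-- The pair of discrete spaces: a finite dimensional velocity space `U_h ⊆ H¹₀(Ω)²` and a finite
dimensional pressure space `M_h ⊆ L²₀(Ω)` of functions with zero mean. -/
structure DiscretePair (Ω : Set Plane) where
  U : Submodule ℝ (H10 Ω)
  M : Submodule ℝ (L2S Ω)
  finite_U : FiniteDimensional ℝ U
  finite_M : FiniteDimensional ℝ M
  mean_zero : ∀ p ∈ M, ∫ x in Ω, p x = 0

/-- The space `V_h` of discretely divergence free functions. -/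
def DiscretePair.V {Ω : Set Plane} (D : DiscretePair Ω) : Submodule ℝ (H10 Ω) where
  carrier := {v | v ∈ D.U ∧ ∀ p ∈ D.M, ⟪divergence Ω v, p⟫_ℝ = 0}
  zero_mem' := ⟨D.U.zero_mem, fun p _ => by simp⟩
  add_mem' := fun ha hb => ⟨D.U.add_mem ha.1 hb.1, fun p hp => by
    rw [map_add, inner_add_left, ha.2 p hp, hb.2 p hp, add_zero]⟩
  smul_mem' := fun a _ hv => ⟨D.U.smul_mem a hv.1, fun p hp => by
    rw [map_smul, inner_smul_left, hv.2 p hp, mul_zero]⟩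

/-- The convection form `c(u, v, w) = ((u · ∇) v, w)`. -/
def convection {Ω : Set Plane} (u v w : H10 Ω) : ℝ :=
  ∫ x in Ω, ∑ i : Fin 2, ∑ j : Fin 2,
    toL2 Ω u x j * grad Ω v x (i, j) * toL2 Ω w x i

/-- The antisymmetrized form `ĉ(u, v, w) = (c(u, v, w) - c(u, w, v)) / 2`. -/
def convectionHat {Ω : Set Plane} (u v w : H10 Ω) : ℝ :=
  (1 / 2) * convection u v w - (1 / 2) * convection u w v

/-! ### Time discretization -/

/-- A partition `0 = t₀ < t₁ < ⋯ < t_N = T`; the values `t m` with `m > N` play no role. -/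
structure TimePartition (T : ℝ) where
  N : ℕ
  t : ℕ → ℝ
  t_zero : t 0 = 0
  t_last : t N = T
  t_lt : ∀ m < N, t m < t (m + 1)

/-- The subinterval `(t_m, t_{m+1}]`, for `m = 0, …, N - 1`. -/
def TimePartition.cell {T : ℝ} (P : TimePartition T) (m : ℕ) : Set ℝ :=
  Ioc (P.t m) (P.t (m + 1))

/-- `u` is a dG(`q`) function with values in the subspace `W`: on each subinterval of the partition
it is a polynomial in time of degree at most `q` with coefficients in `W`. -/
def IsDG {X : Type*} [AddCommGroup X] [Module ℝ X] {T : ℝ} (P : TimePartition T) (q : ℕ)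
    (W : Submodule ℝ X) (u : ℝ → X) : Prop :=
  ∀ m < P.N, ∃ c : Fin (q + 1) → X, (∀ j, c j ∈ W) ∧
    ∀ s ∈ P.cell m, u s = ∑ j : Fin (q + 1), s ^ (j : ℕ) • c j

/-- The jump `[u] = u⁺ - u⁻` at the time `s`. -/
def jump {X : Type*} [AddCommGroup X] [TopologicalSpace X] (u : ℝ → X) (s : ℝ) : X :=
  Function.rightLim u s - Function.leftLim u s

/-- The bilinear form
`𝔅(u, v) = ∑ₘ (∂ₜu, v)_{Iₘ × Ω} + ν (∇u, ∇v)_{I × Ω} + ∑ₘ ([u]ₘ, vₘ⁺) + (u₀⁺, v₀⁺)`, where the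
jumps are taken at the interior nodes `t₁, …, t_{N-1}`. -/
def stokesForm {Ω : Set Plane} {T : ℝ} (P : TimePartition T) (ν : ℝ) (u v : ℝ → H10 Ω) : ℝ :=
  (∑ m ∈ Finset.range P.N, ∫ s in P.cell m, ⟪toL2 Ω (deriv u s), toL2 Ω (v s)⟫_ℝ)
    + ν * (∫ s in Ioc 0 T, ⟪grad Ω (u s), grad Ω (v s)⟫_ℝ)
    + (∑ m ∈ Finset.Ico 1 P.N,
        ⟪toL2 Ω (jump u (P.t m)), toL2 Ω (Function.rightLim v (P.t m))⟫_ℝ)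
    + ⟪toL2 Ω (Function.rightLim u 0), toL2 Ω (Function.rightLim v 0)⟫_ℝ

/-- `u` is a fully discrete dG(`q`) solution of the Navier-Stokes equations with viscosity `ν`,
right hand side `f` and initial value `u₀`. -/
structure IsDiscreteSolution {Ω : Set Plane} {T : ℝ} (D : DiscretePair Ω) (P : TimePartition T)
    (q : ℕ) (ν : ℝ) (f : ℝ → Hm1 Ω) (u₀ : L2V Ω) (u : ℝ → H10 Ω) : Prop where
  isDG : IsDG P q D.V u
  eqn : ∀ v : ℝ → H10 Ω, IsDG P q D.V v →
    stokesForm P ν u v + (∫ s in Ioc 0 T, convectionHat (u s) (u s) (v s))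
      = (∫ s in Ioc 0 T, f s (v s)) + ⟪u₀, toL2 Ω (Function.rightLim v 0)⟫_ℝ

/-- The energy norm `‖u‖_{L^∞(I; L²(Ω))} + √ν ‖u‖_{L²(I; H¹(Ω))}`. -/
def energyNorm {Ω : Set Plane} (T ν : ℝ) (u : ℝ → H10 Ω) : ℝ≥0∞ :=
  eLpNorm (fun s => toL2 Ω (u s)) ∞ (timeMeasure T)
    + ENNReal.ofReal (Real.sqrt ν) * eLpNorm u 2 (timeMeasure T)

end NavierStokesDG

end

open NavierStokesDG

namespace NavierStokesDG

/-! The proof is the energy argument on initial parts of the partition. A dG function may jump at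
the nodes, so the solution set to zero after a node `t_k` is itself an admissible test function.
With it the convection term vanishes at every time by antisymmetry. The time derivatives and the
upwind jumps telescope (`sum_half_sub_add_sum_inner_jump`) to halves of the squared `L²` norms of
the value at `t_k⁻`, of the value at `0⁺` and of all jumps in between; adding the dissipation gives
`IsPiecewiseAffine.dgForm_cutoff`.

These terms control both one-sided values at every node. Since `q ≤ 1`, the solution is affine on
each cell and its norm there is at most the larger of the two end values
(`IsPiecewiseAffine.norm_le`). This bounds the norm in `L^∞(L²)` without a Gronwall argument, hence
without dependence on `T`.

Let `A` and `K` be the norms of the solution in `L^∞(L²)` and `L²(H¹)`. By Hölder the force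
contributes at most `‖f₁‖ A + ‖f₂‖ K`. With `X = A + √ν K` and `F = ‖f₁‖ + ‖f₂‖ / √ν` this yields
`X² ≤ D (F X + ‖u₀‖²)`, which implies the linear bound `X ≤ D (‖u₀‖ + F)`
(`le_of_sq_le_mul_add_sq`). The domain enters `D` only through the Poincaré constant, and the
viscosity enters only as the weight of `f₂`, so it disappears when `f₂ = 0`. -/

theorem IsConvexPolygonalDomain.isBounded {Ω : Set Plane} (h : IsConvexPolygonalDomain Ω) :
    Bornology.IsBounded Ω := by
  obtain ⟨-, S, hS, rfl⟩ := h
  exact (isBounded_convexHull.2 hS.isBounded).subset interior_subset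

/-! ### The Poincaré inequality -/

theorem norm_fderiv_le_norm_gradField (φ : Plane → Plane) (x : Plane) :
    ‖fderiv ℝ φ x‖ ≤ ‖gradField φ x‖ := by
  refine ContinuousLinearMap.opNorm_le_bound _ (norm_nonneg _) fun y => ?_
  have hy : y = y 0 • EuclideanSpace.single 0 1 + y 1 • EuclideanSpace.single 1 1 := by
    ext i; fin_cases i <;> simp
  have hA : ∀ i, fderiv ℝ φ x y i = y 0 * gradField φ x (i, 0) + y 1 * gradField φ x (i, 1) := by
    intro i
    conv_lhs => rw [hy]
    simp [gradField]
  refine le_of_sq_le_sq ?_ (by positivity)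
  rw [mul_pow, EuclideanSpace.norm_sq_eq, EuclideanSpace.norm_sq_eq, EuclideanSpace.norm_sq_eq]
  simp only [Fintype.sum_prod_type, Fin.sum_univ_two, Real.norm_eq_abs, sq_abs, hA]
  -- Cauchy-Schwarz in each row: these squares are the defects in Lagrange's identity.
  nlinarith [sq_nonneg (y 0 * gradField φ x (0, 1) - y 1 * gradField φ x (0, 0)),
    sq_nonneg (y 0 * gradField φ x (1, 1) - y 1 * gradField φ x (1, 0))]

theorem eLpNorm_restrict_of_support_subset {α E : Type*} [MeasurableSpace α] {μ : Measure α}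
    [NormedAddCommGroup E] {f : α → E} {s : Set α} {p : ℝ≥0∞} (h : f.support ⊆ s) :
    eLpNorm f p (μ.restrict s) = eLpNorm f p μ :=
  eLpNorm_restrict_eq_of_support_subset h

/-- The Poincaré inequality for test fields on a bounded set. -/
theorem exists_eLpNorm_le_eLpNorm_gradField {Ω : Set Plane} (hb : Bornology.IsBounded Ω) :
    ∃ C : ℝ≥0, ∀ φ, IsTestField Ω φ →
      eLpNorm φ 2 (volume.restrict Ω) ≤ C * eLpNorm (gradField φ) 2 (volume.restrict Ω) := by
  have hfin : volume Ω ≠ ⊤ := hb.measure_lt_top.ne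
  refine ⟨eLpNormLESNormFDerivOneConst (volume : Measure Plane) 2 *
    ((volume Ω) ^ (1 / (1 : ℝ) - 1 / 2)).toNNReal, fun φ hφ => ?_⟩
  have hd : ContDiff ℝ 1 φ := hφ.smooth.of_le (by exact_mod_cast le_top)
  have hconj : NNReal.HolderConjugate (Module.finrank ℝ Plane) (2 : ℝ≥0) := by
    rw [finrank_euclideanSpace, Fintype.card_fin]
    exact NNReal.HolderConjugate.two_two
  have hsupp : (fderiv ℝ φ).support ⊆ Ω :=
    (support_fderiv_subset ℝ).trans hφ.support
  -- In the plane `2` is the Sobolev exponent of `1`, so the `L²` norm is bounded by the `L¹` norm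
  -- of the derivative; finite measure of `Ω` then allows passing to its `L²` norm.
  calc eLpNorm φ 2 (volume.restrict Ω) ≤ eLpNorm φ 2 volume := eLpNorm_restrict_le _ _ _ _
    _ ≤ eLpNormLESNormFDerivOneConst (volume : Measure Plane) 2 * eLpNorm (fderiv ℝ φ) 1 volume :=
        eLpNorm_le_eLpNorm_fderiv_one volume hd hφ.compact hconj
    _ = eLpNormLESNormFDerivOneConst (volume : Measure Plane) 2 *
          eLpNorm (fderiv ℝ φ) 1 (volume.restrict Ω) := by
        congr 1
        exact (eLpNorm_restrict_of_support_subset hsupp).symm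
    _ ≤ eLpNormLESNormFDerivOneConst (volume : Measure Plane) 2 *
          (eLpNorm (fderiv ℝ φ) 2 (volume.restrict Ω) * (volume Ω) ^ (1 / (1 : ℝ) - 1 / 2)) := by
        gcongr
        have := eLpNorm_le_eLpNorm_mul_rpow_measure_univ (μ := volume.restrict Ω) (p := 1) (q := 2)
          (f := fderiv ℝ φ) (by norm_num)
          (hd.continuous_fderiv one_ne_zero).aestronglyMeasurable
        simpa using this
    _ ≤ eLpNormLESNormFDerivOneConst (volume : Measure Plane) 2 *
          (eLpNorm (gradField φ) 2 (volume.restrict Ω) * (volume Ω) ^ (1 / (1 : ℝ) - 1 / 2)) := by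
        gcongr
        exact eLpNorm_mono (norm_fderiv_le_norm_gradField φ)
    _ = _ := by
        rw [ENNReal.coe_mul, ENNReal.coe_toNNReal (ENNReal.rpow_ne_top_of_nonneg (by norm_num) hfin)]
        ring

/-- The Poincaré inequality in `H¹₀(Ω)²`. -/
theorem exists_norm_toL2_le {Ω : Set Plane} (hb : Bornology.IsBounded Ω) :
    ∃ C : ℝ, 0 ≤ C ∧ ∀ v : H10 Ω, ‖toL2 Ω v‖ ≤ C * ‖grad Ω v‖ := by
  obtain ⟨C, hC⟩ := exists_eLpNorm_le_eLpNorm_gradField hb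
  refine ⟨C, C.2, fun v => ?_⟩
  -- The inequality is a closed condition on pairs (field, gradient), so it passes from test fields
  -- to their closure.
  have hclosed : IsClosed {p : L2Pair Ω |
      ‖WithLp.fstL 2 ℝ (L2V Ω) (L2M Ω) p‖ ≤ C * ‖WithLp.sndL 2 ℝ (L2V Ω) (L2M Ω) p‖} :=
    isClosed_le (by fun_prop) (by fun_prop)
  refine closure_minimal (s := (testGraph Ω : Set (L2Pair Ω))) ?_ hclosed v.2
  rintro p ⟨φ, hφ, h1, h2⟩
  change ‖p.fst‖ ≤ C * ‖p.snd‖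
  rw [Lp.norm_def, Lp.norm_def, eLpNorm_congr_ae h1, eLpNorm_congr_ae h2,
    ← ENNReal.coe_toReal C, ← ENNReal.toReal_mul]
  refine ENNReal.toReal_mono (ENNReal.mul_ne_top ENNReal.coe_ne_top ?_) (hC φ hφ)
  rw [← eLpNorm_congr_ae h2]
  exact Lp.eLpNorm_ne_top _

theorem norm_sq_eq {Ω : Set Plane} (v : H10 Ω) :
    ‖v‖ ^ 2 = ‖toL2 Ω v‖ ^ 2 + ‖grad Ω v‖ ^ 2 :=
  WithLp.prod_norm_sq_eq_of_L2 (v : L2Pair Ω)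

/-- On a bounded set the `H¹` norm is controlled by the gradient. -/
theorem exists_norm_sq_le {Ω : Set Plane} (hb : Bornology.IsBounded Ω) :
    ∃ C : ℝ, 1 ≤ C ∧ ∀ v : H10 Ω, ‖v‖ ^ 2 ≤ C * ‖grad Ω v‖ ^ 2 := by
  obtain ⟨C, hC0, hC⟩ := exists_norm_toL2_le hb
  refine ⟨C ^ 2 + 1, by nlinarith [sq_nonneg C], fun v => ?_⟩
  rw [norm_sq_eq, add_mul, one_mul, ← mul_pow]
  gcongr
  exact hC v

/-! ### Partitions and piecewise affine functions -/

theorem TimePartition.t_mono {T : ℝ} (P : TimePartition T) {m k : ℕ} (hmk : m ≤ k)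
    (hk : k ≤ P.N) : P.t m ≤ P.t k := by
  induction k, hmk using Nat.le_induction with
  | base => exact le_rfl
  | succ k _ ih => exact (ih (by lia)).trans (P.t_lt k (by lia)).le

theorem TimePartition.N_pos {T : ℝ} (P : TimePartition T) (hT : 0 < T) : 0 < P.N := by
  rcases Nat.eq_zero_or_pos P.N with h | h
  · have := P.t_last
    rw [h, P.t_zero] at this
    exact absurd this hT.ne
  · exact h

theorem TimePartition.exists_mem_cell {T : ℝ} (P : TimePartition T) {s : ℝ} (hs : s ∈ Ioc 0 T) :
    ∃ m < P.N, s ∈ P.cell m := by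
  have hex : ∃ k, k ≤ P.N ∧ s ≤ P.t k := ⟨P.N, le_rfl, by rw [P.t_last]; exact hs.2⟩
  classical
  obtain ⟨hk, hsk⟩ := Nat.find_spec hex
  have h0 : Nat.find hex ≠ 0 := by
    intro h
    rw [h, P.t_zero] at hsk
    exact absurd hs.1 (not_lt.2 hsk)
  obtain ⟨m, hm⟩ := Nat.exists_eq_succ_of_ne_zero h0
  have hmin := Nat.find_min hex (m := m) (by lia)
  rw [hm] at hk hsk
  push Not at hmin
  exact ⟨m, hk, hmin (by lia), hsk⟩

theorem TimePartition.cell_subset {T : ℝ} (P : TimePartition T) {m : ℕ} (hm : m < P.N) :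
    P.cell m ⊆ Ioc 0 T := by
  intro s hs
  refine ⟨?_, ?_⟩
  · rw [← P.t_zero]
    exact (P.t_mono (Nat.zero_le m) hm.le).trans_lt hs.1
  · rw [← P.t_last]
    exact hs.2.trans (P.t_mono hm le_rfl)

theorem TimePartition.iUnion_cell {T : ℝ} (P : TimePartition T) :
    ⋃ m : Fin P.N, P.cell m = Ioc 0 T := by
  ext s
  rw [mem_iUnion]
  constructor
  · rintro ⟨m, hm⟩
    exact P.cell_subset m.2 hm
  · intro hs
    obtain ⟨m, hm, h⟩ := P.exists_mem_cell hs
    exact ⟨⟨m, hm⟩, h⟩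

/-- `u` agrees on the cell `m` with the affine function `s ↦ a m + s • b m`. -/
def IsPiecewiseAffine {X : Type*} [AddCommGroup X] [Module ℝ X] {T : ℝ} (P : TimePartition T)
    (a b : ℕ → X) (u : ℝ → X) : Prop :=
  ∀ m < P.N, ∀ s ∈ P.cell m, u s = a m + s • b m

/-- The restriction `q ≤ 1` enters here. For `q = 0` the slope is zero. -/
theorem IsDG.exists_isPiecewiseAffine {X : Type*} [AddCommGroup X] [Module ℝ X] {T : ℝ}
    {P : TimePartition T} {q : ℕ} {W : Submodule ℝ X} {u : ℝ → X} (hq : q = 0 ∨ q = 1)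
    (h : IsDG P q W u) : ∃ a b, IsPiecewiseAffine P a b u := by
  have key : ∀ m, ∃ ab : X × X, m < P.N → ∀ s ∈ P.cell m, u s = ab.1 + s • ab.2 := by
    intro m
    by_cases hm : m < P.N
    · obtain ⟨c, -, hc⟩ := h m hm
      rcases hq with rfl | rfl
      · exact ⟨(c 0, 0), fun _ s hs => by simp [hc s hs]⟩
      · exact ⟨(c 0, c 1), fun _ s hs => by simp [hc s hs]⟩
    · exact ⟨0, fun h => absurd h hm⟩
  choose ab hab using key
  exact ⟨fun m => (ab m).1, fun m => (ab m).2, fun m hm => hab m hm⟩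

/-- The function `u` set to zero after the time `τ`. -/
noncomputable def cutoff {X : Type*} [Zero X] (u : ℝ → X) (τ : ℝ) : ℝ → X := (Iic τ).indicator u

theorem cutoff_of_le {X : Type*} [Zero X] {u : ℝ → X} {τ s : ℝ} (h : s ≤ τ) :
    cutoff u τ s = u s := indicator_of_mem (mem_Iic.2 h) u

theorem cutoff_of_lt {X : Type*} [Zero X] {u : ℝ → X} {τ s : ℝ} (h : τ < s) :
    cutoff u τ s = 0 := indicator_of_notMem (by simpa using h) u

theorem norm_cutoff_le {X : Type*} [NormedAddCommGroup X] (u : ℝ → X) (τ s : ℝ) :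
    ‖cutoff u τ s‖ ≤ ‖u s‖ := norm_indicator_le_norm_self _ _

theorem cutoff_of_mem_cell {X : Type*} [Zero X] {u : ℝ → X} {T : ℝ} {P : TimePartition T}
    {m k : ℕ} (hmk : m < k) (hk : k ≤ P.N) {s : ℝ} (hs : s ∈ P.cell m) :
    cutoff u (P.t k) s = u s := cutoff_of_le (hs.2.trans (P.t_mono hmk hk))

theorem cutoff_of_mem_cell_of_le {X : Type*} [Zero X] {u : ℝ → X} {T : ℝ} {P : TimePartition T}
    {m k : ℕ} (hkm : k ≤ m) (hm : m < P.N) {s : ℝ} (hs : s ∈ P.cell m) :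
    cutoff u (P.t k) s = 0 := cutoff_of_lt ((P.t_mono hkm hm.le).trans_lt hs.1)

/-- No continuity is imposed at the nodes, and the cells are closed on the right, so cutting at a
node keeps or kills whole cells. -/
theorem IsDG.cutoff {X : Type*} [AddCommGroup X] [Module ℝ X] {T : ℝ} {P : TimePartition T}
    {q : ℕ} {W : Submodule ℝ X} {u : ℝ → X} (h : IsDG P q W u) {k : ℕ} (hk : k ≤ P.N) :
    IsDG P q W (cutoff u (P.t k)) := by
  intro m hm
  by_cases hmk : m < k
  · obtain ⟨c, hcW, hc⟩ := h m hm
    exact ⟨c, hcW, fun s hs => by rw [cutoff_of_mem_cell hmk hk hs, hc s hs]⟩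
  · exact ⟨0, fun _ => W.zero_mem, fun s hs => by
      simp [cutoff_of_mem_cell_of_le (not_lt.1 hmk) hm hs]⟩

/-! ### One-sided limits and energy of affine pieces -/

section OneSidedLimits

variable {X : Type*} [NormedAddCommGroup X] [NormedSpace ℝ X]

theorem rightLim_eq_of_affine {u : ℝ → X} {a b : X} {α β : ℝ} (h : α < β)
    (hu : ∀ s ∈ Ioc α β, u s = a + s • b) : Function.rightLim u α = a + α • b := by
  have hc : Continuous fun s : ℝ => a + s • b := by fun_prop
  refine rightLim_eq_of_tendsto (((hc.tendsto α).mono_left nhdsWithin_le_nhds).congr' ?_)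
  filter_upwards [Ioc_mem_nhdsGT h] with s hs using (hu s hs).symm

theorem leftLim_eq_of_affine {u : ℝ → X} {a b : X} {α β : ℝ} (h : α < β)
    (hu : ∀ s ∈ Ioc α β, u s = a + s • b) : Function.leftLim u β = a + β • b := by
  have hc : Continuous fun s : ℝ => a + s • b := by fun_prop
  refine leftLim_eq_of_tendsto (((hc.tendsto β).mono_left nhdsWithin_le_nhds).congr' ?_)
  filter_upwards [Ioo_mem_nhdsLT h] with s hs using (hu s ⟨hs.1, hs.2.le⟩).symm

theorem setIntegral_inner_deriv_of_affine {Y : Type*} [NormedAddCommGroup Y]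
    [InnerProductSpace ℝ Y] (L : X →L[ℝ] Y) {u v : ℝ → X} {a b : X} {α β : ℝ} (h : α < β)
    (hu : ∀ s ∈ Ioc α β, u s = a + s • b) (hv : ∀ s ∈ Ioc α β, v s = u s) :
    ∫ s in Ioc α β, ⟪L (deriv u s), L (v s)⟫_ℝ
      = 1 / 2 * (‖L (a + β • b)‖ ^ 2 - ‖L (a + α • b)‖ ^ 2) := by
  have hderiv : ∀ s, HasDerivAt (fun s : ℝ => a + s • b) b s := fun s => by
    simpa using ((hasDerivAt_id s).smul_const b).const_add a
  have hcongr : ∫ s in Ioc α β, ⟪L (deriv u s), L (v s)⟫_ℝ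
      = ∫ s in Ioc α β, ⟪L (a + s • b), L b⟫_ℝ := by
    -- At `β` the function may jump and `deriv u` need not be the slope; this endpoint is a null
    -- set.
    rw [integral_Ioc_eq_integral_Ioo, integral_Ioc_eq_integral_Ioo]
    refine setIntegral_congr_fun measurableSet_Ioo fun s hs => ?_
    have hs' : s ∈ Ioc α β := ⟨hs.1, hs.2.le⟩
    have heq : u =ᶠ[𝓝 s] fun s => a + s • b := by
      filter_upwards [Ioo_mem_nhds hs.1 hs.2] with r hr using hu r ⟨hr.1, hr.2.le⟩
    simp only [heq.deriv_eq, (hderiv s).deriv, hv s hs', hu s hs']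
    rw [real_inner_comm]
  rw [hcongr, ← intervalIntegral.integral_of_le h.le]
  have hprim : ∀ s ∈ uIcc α β,
      HasDerivAt (fun s : ℝ => 1 / 2 * ‖L (a + s • b)‖ ^ 2) ⟪L (a + s • b), L b⟫_ℝ s := by
    intro s _
    have h1 : HasDerivAt (fun s : ℝ => L (a + s • b)) (L b) s :=
      L.hasFDerivAt.comp_hasDerivAt s (hderiv s)
    exact (h1.norm_sq.const_mul (1 / 2)).congr_deriv (by ring)
  rw [intervalIntegral.integral_eq_sub_of_hasDerivAt hprim
    (Continuous.intervalIntegrable (by fun_prop) _ _)]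
  ring

end OneSidedLimits

/-- A telescoping identity for upwind jumps: `s m` and `e m` are the initial and the final value
on the cell `m`. -/
theorem sum_half_sub_add_sum_inner_jump {Y : Type*} [NormedAddCommGroup Y]
    [InnerProductSpace ℝ Y] (e s : ℕ → Y) (k : ℕ) :
    (∑ m ∈ Finset.range (k + 1), 1 / 2 * (‖e m‖ ^ 2 - ‖s m‖ ^ 2))
      + (∑ m ∈ Finset.Ico 1 (k + 1), ⟪s m - e (m - 1), s m⟫_ℝ) + ‖s 0‖ ^ 2
      = 1 / 2 * ‖e k‖ ^ 2 + 1 / 2 * ‖s 0‖ ^ 2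
        + 1 / 2 * ∑ m ∈ Finset.Ico 1 (k + 1), ‖s m - e (m - 1)‖ ^ 2 := by
  induction k with
  | zero => simp; ring
  | succ k ih =>
    rw [Finset.sum_range_succ, Finset.sum_Ico_succ_top (by lia : 1 ≤ k + 1),
      Finset.sum_Ico_succ_top (by lia : 1 ≤ k + 1)]
    simp only [add_tsub_cancel_right]
    -- Polarization: testing a jump with its upper value yields half the difference of squares plus
    -- half the squared jump.
    have h : ‖e k‖ ^ 2 = ‖s (k + 1) - e k‖ ^ 2 - 2 * ⟪s (k + 1) - e k, s (k + 1)⟫_ℝ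
        + ‖s (k + 1)‖ ^ 2 := by
      rw [← norm_sub_sq_real, sub_sub_cancel_left, norm_neg]
    linarith

/-! ### The energy identity -/

theorem convectionHat_self {Ω : Set Plane} (u v : H10 Ω) : convectionHat u v v = 0 := by
  simp [convectionHat]

theorem convectionHat_zero_right {Ω : Set Plane} (u v : H10 Ω) : convectionHat u v 0 = 0 := by
  have h1 : convection u v 0 = 0 := by
    refine integral_eq_zero_of_ae ?_
    rw [map_zero]
    filter_upwards [Lp.coeFn_zero Plane 2 (volume.restrict Ω)] with x hx
    simp only [hx]
    simp
  have h2 : convection u 0 v = 0 := by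
    refine integral_eq_zero_of_ae ?_
    rw [map_zero]
    filter_upwards [Lp.coeFn_zero Arr 2 (volume.restrict Ω)] with x hx
    simp only [hx]
    simp
  rw [convectionHat, h1, h2]
  simp

/-- Up to `τ` the last two arguments coincide, afterwards the last one is zero; no integrability of
the convection term is needed. -/
theorem convectionHat_cutoff {Ω : Set Plane} (u : ℝ → H10 Ω) (τ s : ℝ) :
    convectionHat (u s) (u s) (cutoff u τ s) = 0 := by
  rcases le_or_gt s τ with h | h
  · rw [cutoff_of_le h, convectionHat_self]
  · rw [cutoff_of_lt h, convectionHat_zero_right]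

theorem IsPiecewiseAffine.rightLim_cutoff {X : Type*} [NormedAddCommGroup X] [NormedSpace ℝ X]
    {T : ℝ} {P : TimePartition T} {a b : ℕ → X} {u : ℝ → X} (hu : IsPiecewiseAffine P a b u)
    {m k : ℕ} (hmk : m < k) (hk : k ≤ P.N) :
    Function.rightLim (cutoff u (P.t k)) (P.t m) = a m + P.t m • b m :=
  rightLim_eq_of_affine (P.t_lt m (by lia)) fun s hs => by
    rw [cutoff_of_mem_cell hmk hk hs, hu m (by lia) s hs]

/-- Includes the cutting node `m = k`. The form sees the test function at a node only through its
right limit, so the artificial jump contributes nothing. -/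
theorem rightLim_cutoff_of_le {X : Type*} [NormedAddCommGroup X] [NormedSpace ℝ X]
    {T : ℝ} {P : TimePartition T} {u : ℝ → X} {m k : ℕ} (hkm : k ≤ m) (hm : m < P.N) :
    Function.rightLim (cutoff u (P.t k)) (P.t m) = 0 := by
  simpa using rightLim_eq_of_affine (u := cutoff u (P.t k)) (a := 0) (b := 0) (P.t_lt m hm)
    fun s hs => by simp [cutoff_of_mem_cell_of_le hkm hm hs]

theorem IsPiecewiseAffine.jump_succ {X : Type*} [NormedAddCommGroup X] [NormedSpace ℝ X]
    {T : ℝ} {P : TimePartition T} {a b : ℕ → X} {u : ℝ → X} (hu : IsPiecewiseAffine P a b u)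
    {m : ℕ} (hm : m + 1 < P.N) :
    jump u (P.t (m + 1)) = a (m + 1) + P.t (m + 1) • b (m + 1) - (a m + P.t (m + 1) • b m) := by
  rw [jump, rightLim_eq_of_affine (P.t_lt (m + 1) hm) (hu (m + 1) hm),
    leftLim_eq_of_affine (P.t_lt m (by lia)) (hu m (by lia))]

section Cutoff

variable {X Y : Type*} [NormedAddCommGroup X] [NormedSpace ℝ X] [NormedAddCommGroup Y]
  [InnerProductSpace ℝ Y] {T : ℝ} {P : TimePartition T} {a b : ℕ → X} {u : ℝ → X} {k : ℕ}

theorem IsPiecewiseAffine.sum_integral_inner_deriv_cutoff (hu : IsPiecewiseAffine P a b u)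
    (L : X →L[ℝ] Y) (hk : k ≤ P.N) :
    (∑ m ∈ Finset.range P.N, ∫ s in P.cell m, ⟪L (deriv u s), L (cutoff u (P.t k) s)⟫_ℝ)
      = ∑ m ∈ Finset.range k, 1 / 2 * (‖L (a m + P.t (m + 1) • b m)‖ ^ 2
          - ‖L (a m + P.t m • b m)‖ ^ 2) := by
  symm
  refine Finset.sum_subset_zero_on_sdiff (Finset.range_mono hk) ?_ ?_
  · intro m hm
    rw [Finset.mem_sdiff, Finset.mem_range, Finset.mem_range, not_lt] at hm
    refine setIntegral_eq_zero_of_forall_eq_zero fun s hs => ?_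
    rw [cutoff_of_mem_cell_of_le hm.2 hm.1 hs, map_zero, inner_zero_right]
  · intro m hm
    rw [Finset.mem_range] at hm
    exact (setIntegral_inner_deriv_of_affine _ (P.t_lt m (by lia)) (hu m (by lia))
      fun s hs => cutoff_of_mem_cell hm hk hs).symm

theorem setIntegral_inner_cutoff (L : X →L[ℝ] Y) {τ : ℝ} (hτ : τ ≤ T) :
    (∫ s in Ioc 0 T, ⟪L (u s), L (cutoff u τ s)⟫_ℝ) = ∫ s in Ioc 0 τ, ‖L (u s)‖ ^ 2 := by
  have hset : Ioc 0 τ = Ioc 0 T ∩ Iic τ := by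
    rw [Ioc_inter_Iic, inf_eq_right.2 hτ]
  rw [hset, ← setIntegral_indicator measurableSet_Iic]
  congr 1 with s
  by_cases hs : s ≤ τ
  · rw [cutoff_of_le hs, indicator_of_mem (mem_Iic.2 hs), real_inner_self_eq_norm_sq]
  · rw [cutoff_of_lt (not_le.1 hs), indicator_of_notMem (by simpa using hs), map_zero,
      inner_zero_right]

/-- The node is written `P.t (m - 1 + 1)` so that the subtracted term is literally the final value
on the cell `m - 1`, as the telescoping identity requires. -/
theorem IsPiecewiseAffine.sum_inner_jump_cutoff (hu : IsPiecewiseAffine P a b u)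
    (L : X →L[ℝ] Y) (hk : k ≤ P.N) :
    (∑ m ∈ Finset.Ico 1 P.N, ⟪L (jump u (P.t m)),
      L (Function.rightLim (cutoff u (P.t k)) (P.t m))⟫_ℝ)
      = ∑ m ∈ Finset.Ico 1 k, ⟪L (a m + P.t m • b m)
          - L (a (m - 1) + P.t (m - 1 + 1) • b (m - 1)), L (a m + P.t m • b m)⟫_ℝ := by
  symm
  refine Finset.sum_subset_zero_on_sdiff (Finset.Ico_subset_Ico_right hk) ?_ ?_
  · intro m hm
    rw [Finset.mem_sdiff, Finset.mem_Ico, Finset.mem_Ico] at hm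
    rw [rightLim_cutoff_of_le (by lia) (by lia), map_zero, inner_zero_right]
  · intro m hm
    rw [Finset.mem_Ico] at hm
    obtain ⟨m, rfl⟩ := Nat.exists_eq_succ_of_ne_zero (by lia : m ≠ 0)
    simp only [Nat.succ_eq_add_one, add_tsub_cancel_right]
    rw [hu.rightLim_cutoff (by lia) hk, hu.jump_succ (by lia), map_sub]

/-- The form `stokesForm` for an abstract embedding `L` and an abstract gradient `G`. -/
noncomputable def dgForm {Z : Type*} [NormedAddCommGroup Z] [InnerProductSpace ℝ Z]
    (P : TimePartition T) (ν : ℝ) (L : X →L[ℝ] Y) (G : X →L[ℝ] Z) (u v : ℝ → X) : ℝ :=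
  (∑ m ∈ Finset.range P.N, ∫ s in P.cell m, ⟪L (deriv u s), L (v s)⟫_ℝ)
    + ν * (∫ s in Ioc 0 T, ⟪G (u s), G (v s)⟫_ℝ)
    + (∑ m ∈ Finset.Ico 1 P.N, ⟪L (jump u (P.t m)), L (Function.rightLim v (P.t m))⟫_ℝ)
    + ⟪L (Function.rightLim u 0), L (Function.rightLim v 0)⟫_ℝ

/-- The energy identity on an initial part of the partition. -/
theorem IsPiecewiseAffine.dgForm_cutoff {Z : Type*} [NormedAddCommGroup Z]
    [InnerProductSpace ℝ Z] (hu : IsPiecewiseAffine P a b u) (ν : ℝ) (L : X →L[ℝ] Y)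
    (G : X →L[ℝ] Z) (hk : k < P.N) :
    dgForm P ν L G u (cutoff u (P.t (k + 1)))
      = 1 / 2 * ‖L (a k + P.t (k + 1) • b k)‖ ^ 2 + 1 / 2 * ‖L (a 0 + P.t 0 • b 0)‖ ^ 2
        + 1 / 2 * (∑ m ∈ Finset.Ico 1 (k + 1), ‖L (a m + P.t m • b m)
            - L (a (m - 1) + P.t (m - 1 + 1) • b (m - 1))‖ ^ 2)
        + ν * ∫ s in Ioc 0 (P.t (k + 1)), ‖G (u s)‖ ^ 2 := by
  have h4 := hu.rightLim_cutoff (Nat.succ_pos k) hk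
  have h5 : Function.rightLim u (P.t 0) = a 0 + P.t 0 • b 0 :=
    rightLim_eq_of_affine (P.t_lt 0 (by lia)) (hu 0 (by lia))
  have hsum := sum_half_sub_add_sum_inner_jump (fun m => L (a m + P.t (m + 1) • b m))
    (fun m => L (a m + P.t m • b m)) k
  rw [P.t_zero] at h4 h5
  simp only [P.t_zero] at hsum ⊢
  rw [← hsum, dgForm, hu.sum_integral_inner_deriv_cutoff L hk,
    setIntegral_inner_cutoff G ((P.t_mono hk le_rfl).trans_eq P.t_last),
    hu.sum_inner_jump_cutoff L hk, h4, h5, real_inner_self_eq_norm_sq]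
  ring

end Cutoff

/-! ### Consequences of the energy identity -/

/-- On a cell an affine function is a convex combination of its two end values, and balls are
convex. -/
theorem IsPiecewiseAffine.norm_le {X Y : Type*} [NormedAddCommGroup X] [NormedSpace ℝ X]
    [NormedAddCommGroup Y] [NormedSpace ℝ Y] {T : ℝ} {P : TimePartition T} {a b : ℕ → X}
    {u : ℝ → X} (hu : IsPiecewiseAffine P a b u) (L : X →L[ℝ] Y) {B : ℝ}
    (hs : ∀ m < P.N, ‖L (a m + P.t m • b m)‖ ≤ B)
    (he : ∀ m < P.N, ‖L (a m + P.t (m + 1) • b m)‖ ≤ B) {s : ℝ} (hsT : s ∈ Ioc 0 T) :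
    ‖L (u s)‖ ≤ B := by
  obtain ⟨m, hm, hsm⟩ := P.exists_mem_cell hsT
  have hlt := sub_pos.2 (P.t_lt m hm)
  set θ := (s - P.t m) / (P.t (m + 1) - P.t m) with hθ
  have h0 : 0 ≤ θ := div_nonneg (sub_nonneg.2 hsm.1.le) hlt.le
  have h1 : θ ≤ 1 := (div_le_one hlt).2 (by linarith [hsm.2])
  have hsθ : s = (1 - θ) * P.t m + θ * P.t (m + 1) := by
    rw [hθ]; field_simp; ring
  have hrepr : u s = (1 - θ) • (a m + P.t m • b m) + θ • (a m + P.t (m + 1) • b m) := by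
    rw [hu m hm s hsm]
    nth_rw 1 [hsθ]
    module
  rw [hrepr, map_add, map_smul, map_smul, ← mem_closedBall_zero_iff]
  exact convex_closedBall 0 B (by simpa using hs m hm) (by simpa using he m hm)
    (by linarith) h0 (by ring)

theorem IsPiecewiseAffine.memLp {X : Type*} [NormedAddCommGroup X] [NormedSpace ℝ X]
    {T : ℝ} {P : TimePartition T} {a b : ℕ → X} {u : ℝ → X} (hu : IsPiecewiseAffine P a b u)
    (p : ℝ≥0∞) : MemLp u p (timeMeasure T) := by
  have hmeas : AEStronglyMeasurable u (timeMeasure T) := by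
    rw [timeMeasure, ← P.iUnion_cell]
    refine AEStronglyMeasurable.iUnion fun m => ?_
    refine AEStronglyMeasurable.congr (f := fun s => a m + s • b m)
      (Continuous.aestronglyMeasurable (by fun_prop)) ?_
    exact (ae_restrict_mem measurableSet_Ioc).mono fun s hs => (hu m m.2 s hs).symm
  refine MemLp.of_bound hmeas (∑ m ∈ Finset.range P.N,
    (‖a m + P.t m • b m‖ + ‖a m + P.t (m + 1) • b m‖)) ?_
  refine (ae_restrict_mem measurableSet_Ioc).mono fun s hs => ?_
  have hle : ∀ m < P.N, ‖a m + P.t m • b m‖ + ‖a m + P.t (m + 1) • b m‖ ≤ _ := fun m hm =>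
    Finset.single_le_sum (f := fun m => ‖a m + P.t m • b m‖ + ‖a m + P.t (m + 1) • b m‖)
      (fun i _ => by positivity) (Finset.mem_range.2 hm)
  refine hu.norm_le (ContinuousLinearMap.id ℝ X) (fun m hm => ?_) (fun m hm => ?_) hs
  · exact (le_add_of_nonneg_right (norm_nonneg _)).trans (hle m hm)
  · exact (le_add_of_nonneg_left (norm_nonneg _)).trans (hle m hm)

/-- Bounds for the final values `e m` and the initial values `s m` on the cells from the energy
inequalities on all initial parts of the partition. -/
theorem norm_sq_le_of_energy {Y : Type*} [NormedAddCommGroup Y] {N : ℕ} (hN : 0 < N)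
    {e s : ℕ → Y} {Q : ℝ} {G : ℕ → ℝ} (hG : ∀ k, 0 ≤ G k)
    (key : ∀ k < N, 1 / 2 * ‖e k‖ ^ 2 + 1 / 4 * ‖s 0‖ ^ 2
      + 1 / 2 * (∑ m ∈ Finset.Ico 1 (k + 1), ‖s m - e (m - 1)‖ ^ 2) + G k ≤ Q) :
    (∀ m < N, ‖e m‖ ^ 2 ≤ 8 * Q) ∧ (∀ m < N, ‖s m‖ ^ 2 ≤ 8 * Q) ∧ (∀ m < N, G m ≤ Q) := by
  have hjump : ∀ k, 0 ≤ ∑ m ∈ Finset.Ico 1 (k + 1), ‖s m - e (m - 1)‖ ^ 2 := fun k =>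
    Finset.sum_nonneg fun m _ => by positivity
  have hend : ∀ m < N, ‖e m‖ ^ 2 ≤ 2 * Q := fun m hm => by
    linarith [key m hm, hjump m, hG m, sq_nonneg ‖s 0‖]
  have hQ0 : 0 ≤ Q := by linarith [hend 0 hN, sq_nonneg ‖e 0‖]
  refine ⟨fun m hm => by linarith [hend m hm], fun m hm => ?_, fun m hm => by
    linarith [key m hm, hjump m, sq_nonneg ‖s 0‖, sq_nonneg ‖e m‖]⟩
  -- The first initial value is read off from the quarter term. A later one is the preceding final
  -- value plus a jump; both have square at most `2 * Q`, whence the factor `8`.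
  rcases m with _ | m
  · linarith [key 0 hN, hjump 0, hG 0, sq_nonneg ‖e 0‖]
  · have hj := Finset.single_le_sum (f := fun m => ‖s m - e (m - 1)‖ ^ 2)
      (fun i _ => by positivity) (Finset.mem_Ico.2 ⟨by lia, by lia⟩ :
        m + 1 ∈ Finset.Ico 1 (m + 1 + 1))
    simp only [add_tsub_cancel_right] at hj
    have hj' : ‖s (m + 1) - e m‖ ^ 2 ≤ 2 * Q := by
      linarith [key (m + 1) hm, hG (m + 1), sq_nonneg ‖s 0‖, sq_nonneg ‖e (m + 1)‖]
    have hsq := pow_le_pow_left₀ (norm_nonneg _) (norm_le_norm_sub_add (s (m + 1)) (e m)) 2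
    linarith [add_sq_le (a := ‖s (m + 1) - e m‖) (b := ‖e m‖), hend m (by lia)]

/-- The energy estimate in terms of a bound `R` for the right hand side. -/
theorem IsPiecewiseAffine.energy_le {X Y Z : Type*} [NormedAddCommGroup X] [NormedSpace ℝ X]
    [NormedAddCommGroup Y] [InnerProductSpace ℝ Y] [NormedAddCommGroup Z] [InnerProductSpace ℝ Z]
    {T : ℝ} (hT : 0 < T) {P : TimePartition T} {a b : ℕ → X} {u : ℝ → X}
    (hu : IsPiecewiseAffine P a b u) {ν : ℝ} (hν : 0 < ν) (L : X →L[ℝ] Y) (G : X →L[ℝ] Z)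
    {u₀ : Y} {R : ℝ}
    (hR : ∀ k ≤ P.N, dgForm P ν L G u (cutoff u (P.t k))
      ≤ R + ⟪u₀, L (Function.rightLim (cutoff u (P.t k)) 0)⟫_ℝ) :
    (∀ s ∈ Ioc 0 T, ‖L (u s)‖ ^ 2 ≤ 8 * (R + ‖u₀‖ ^ 2)) ∧
      ν * ∫ s in Ioc 0 T, ‖G (u s)‖ ^ 2 ≤ R + ‖u₀‖ ^ 2 := by
  have hN := P.N_pos hT
  have key : ∀ k < P.N, 1 / 2 * ‖L (a k + P.t (k + 1) • b k)‖ ^ 2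
        + 1 / 4 * ‖L (a 0 + P.t 0 • b 0)‖ ^ 2
        + 1 / 2 * (∑ m ∈ Finset.Ico 1 (k + 1), ‖L (a m + P.t m • b m)
            - L (a (m - 1) + P.t (m - 1 + 1) • b (m - 1))‖ ^ 2)
        + ν * ∫ s in Ioc 0 (P.t (k + 1)), ‖G (u s)‖ ^ 2 ≤ R + ‖u₀‖ ^ 2 := by
    intro k hk
    have hle := hR (k + 1) hk
    have hr := hu.rightLim_cutoff (Nat.succ_pos k) hk
    rw [hu.dgForm_cutoff ν L G hk, show Function.rightLim (cutoff u (P.t (k + 1))) 0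
      = a 0 + P.t 0 • b 0 by rw [← hr, P.t_zero]] at hle
    -- Young's inequality in the form `‖u₀‖ ‖s‖ ≤ ‖u₀‖² + ‖s‖² / 4`: half of the available `‖s‖² /
    -- 2` is spent, and the rest is the quarter term.
    linarith [real_inner_le_norm u₀ (L (a 0 + P.t 0 • b 0)),
      two_mul_le_add_sq ‖u₀‖ (1 / 2 * ‖L (a 0 + P.t 0 • b 0)‖)]
  obtain ⟨hend, hstart, hG⟩ := norm_sq_le_of_energy hN
    (e := fun m => L (a m + P.t (m + 1) • b m)) (s := fun m => L (a m + P.t m • b m))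
    (G := fun m => ν * ∫ s in Ioc 0 (P.t (m + 1)), ‖G (u s)‖ ^ 2)
    (fun k => mul_nonneg hν.le (integral_nonneg fun s => by positivity)) key
  refine ⟨fun s hs => ?_, ?_⟩
  · have hQ : 0 ≤ 8 * (R + ‖u₀‖ ^ 2) := (sq_nonneg _).trans (hend 0 hN)
    refine (Real.le_sqrt (norm_nonneg _) hQ).1 (hu.norm_le L ?_ ?_ hs)
    · exact fun m hm => Real.le_sqrt_of_sq_le (hstart m hm)
    · exact fun m hm => Real.le_sqrt_of_sq_le (hend m hm)
  · have hk := hG (P.N - 1) (by lia)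
    simpa only [Nat.sub_add_cancel hN, P.t_last] using hk

theorem IsDiscreteSolution.dgForm_cutoff {Ω : Set Plane} {T : ℝ} {D : DiscretePair Ω}
    {P : TimePartition T} {q : ℕ} {ν : ℝ} {f : ℝ → Hm1 Ω} {u₀ : L2V Ω} {u : ℝ → H10 Ω}
    (h : IsDiscreteSolution D P q ν f u₀ u) {k : ℕ} (hk : k ≤ P.N) :
    dgForm P ν (toL2 Ω) (grad Ω) u (cutoff u (P.t k))
      = (∫ s in Ioc 0 T, f s (cutoff u (P.t k) s))
        + ⟪u₀, toL2 Ω (Function.rightLim (cutoff u (P.t k)) 0)⟫_ℝ := by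
  have heq := h.eqn _ (h.isDG.cutoff hk)
  have hconv : ∫ s in Ioc 0 T, convectionHat (u s) (u s) (cutoff u (P.t k) s) = 0 := by
    simp only [convectionHat_cutoff, integral_zero]
  rw [hconv, add_zero] at heq
  -- `stokesForm` is by definition `dgForm` for `toL2` and `grad`.
  exact heq

/-! ### The stability estimate -/

theorem lintegral_enorm_mul_enorm_le {α E F : Type*} [MeasurableSpace α] {μ : Measure α}
    [NormedAddCommGroup E] [NormedAddCommGroup F] {f : α → E} {g : α → F} {p q : ℝ≥0∞}
    [ENNReal.HolderTriple p q 1] (hf : AEStronglyMeasurable f μ) (hg : AEStronglyMeasurable g μ) :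
    ∫⁻ x, ‖f x‖ₑ * ‖g x‖ₑ ∂μ ≤ eLpNorm f p μ * eLpNorm g q μ := by
  have h := eLpNorm_le_eLpNorm_mul_eLpNorm_of_nnnorm (p := p) (q := q) (r := 1) hf hg
    (fun x y => ‖x‖ * ‖y‖) 1 (Eventually.of_forall fun x => by simp)
  rw [eLpNorm_one_eq_lintegral_enorm] at h
  simpa [enorm_mul] using h

theorem MemLp.toReal_eLpNorm_two_sq {α E : Type*} [MeasurableSpace α] {μ : Measure α}
    [NormedAddCommGroup E] {f : α → E} (hf : MemLp f 2 μ) :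
    (eLpNorm f 2 μ).toReal ^ 2 = ∫ x, ‖f x‖ ^ 2 ∂μ := by
  have h0 : 0 ≤ ∫ x, ‖f x‖ ^ 2 ∂μ := integral_nonneg fun x => by positivity
  rw [hf.eLpNorm_eq_integral_rpow_norm two_ne_zero ENNReal.ofNat_ne_top]
  simp only [ENNReal.toReal_ofNat, Real.rpow_ofNat]
  rw [ENNReal.toReal_ofReal (by positivity), ← Real.rpow_natCast, ← Real.rpow_mul h0]
  norm_num

section Abstract

variable {X Y Z : Type*} [NormedAddCommGroup X] [NormedSpace ℝ X] [NormedAddCommGroup Y]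
  [InnerProductSpace ℝ Y] [NormedAddCommGroup Z] [InnerProductSpace ℝ Z] {T : ℝ}

theorem enorm_innerSL_comp_apply_le (L : X →L[ℝ] Y) (g : Y) (v : X) :
    ‖((innerSL ℝ g).comp L) v‖ₑ ≤ ‖g‖ₑ * ‖L v‖ₑ := by
  rw [← ofReal_norm, ← ofReal_norm, ← ofReal_norm, ← ENNReal.ofReal_mul (norm_nonneg _)]
  exact ENNReal.ofReal_le_ofReal (norm_inner_le_norm g (L v))

theorem map_cutoff (L : X →L[ℝ] Y) (u : ℝ → X) (τ s : ℝ) :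
    L (cutoff u τ s) = cutoff (fun s => L (u s)) τ s := by
  rcases le_or_gt s τ with h | h
  · rw [cutoff_of_le h, cutoff_of_le h]
  · rw [cutoff_of_lt h, cutoff_of_lt h, map_zero]

/-- The bound for the work of the force by Hölder's inequality. -/
theorem integral_apply_cutoff_le (L : X →L[ℝ] Y) {f f₂ : ℝ → StrongDual ℝ X} {f₁ : ℝ → Y}
    (hf₁ : MemLp f₁ 1 (timeMeasure T)) (hf₂ : MemLp f₂ 2 (timeMeasure T))
    (hf : f =ᵐ[timeMeasure T] fun s => (innerSL ℝ (f₁ s)).comp L + f₂ s) {u : ℝ → X}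
    (hu2 : MemLp u 2 (timeMeasure T)) (hu : MemLp (fun s => L (u s)) ∞ (timeMeasure T))
    (τ : ℝ) :
    ∫ s in Ioc 0 T, f s (cutoff u τ s)
      ≤ (eLpNorm f₁ 1 (timeMeasure T)).toReal
          * (eLpNorm (fun s => L (u s)) ∞ (timeMeasure T)).toReal
        + (eLpNorm f₂ 2 (timeMeasure T)).toReal * (eLpNorm u 2 (timeMeasure T)).toReal := by
  have hfin1 := ENNReal.mul_ne_top hf₁.eLpNorm_ne_top hu.eLpNorm_ne_top
  have hfin2 := ENNReal.mul_ne_top hf₂.eLpNorm_ne_top hu2.eLpNorm_ne_top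
  rw [← ENNReal.toReal_mul, ← ENNReal.toReal_mul, ← ENNReal.toReal_add hfin1 hfin2]
  refine (ENNReal.ofReal_le_iff_le_toReal (ENNReal.add_ne_top.2 ⟨hfin1, hfin2⟩)).1 ?_
  -- Cutting only decreases norms, so the bound is the same for every `τ`.
  have hpt : ∀ᵐ s ∂timeMeasure T, ‖f s (cutoff u τ s)‖ₑ
      ≤ ‖f₁ s‖ₑ * ‖L (u s)‖ₑ + ‖f₂ s‖ₑ * ‖u s‖ₑ := by
    filter_upwards [hf] with s hs
    rw [hs, add_apply]
    refine (enorm_add_le _ _).trans (add_le_add ?_ ?_)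
    · refine (enorm_innerSL_comp_apply_le L _ _).trans (mul_le_mul_right ?_ _)
      rw [map_cutoff]
      exact enorm_le_iff_norm_le.2 (norm_cutoff_le _ τ s)
    · refine ((f₂ s).le_opENorm _).trans (mul_le_mul_right ?_ _)
      exact enorm_le_iff_norm_le.2 (norm_cutoff_le u τ s)
  calc ENNReal.ofReal (∫ s in Ioc 0 T, f s (cutoff u τ s))
      ≤ ‖∫ s in Ioc 0 T, f s (cutoff u τ s)‖ₑ := by
        rw [← ofReal_norm]; exact ENNReal.ofReal_le_ofReal (Real.le_norm_self _)
    _ ≤ ∫⁻ s in Ioc 0 T, ‖f s (cutoff u τ s)‖ₑ := enorm_integral_le_lintegral_enorm _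
    _ ≤ ∫⁻ s in Ioc 0 T, (‖f₁ s‖ₑ * ‖L (u s)‖ₑ + ‖f₂ s‖ₑ * ‖u s‖ₑ) :=
        lintegral_mono_ae hpt
    _ = (∫⁻ s in Ioc 0 T, ‖f₁ s‖ₑ * ‖L (u s)‖ₑ) + ∫⁻ s in Ioc 0 T, ‖f₂ s‖ₑ * ‖u s‖ₑ :=
        lintegral_add_left' (hf₁.1.enorm.mul hu.1.enorm) _
    _ ≤ _ := add_le_add (lintegral_enorm_mul_enorm_le hf₁.1 hu.1)
        (lintegral_enorm_mul_enorm_le hf₂.1 hu2.1)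

/-- If the bound failed, then `U ≤ X`, so `U ^ 2 ≤ U * X`, and the hypothesis would give `X ^ 2 ≤ D
* (F + U) * X < X ^ 2`. -/
theorem le_of_sq_le_mul_add_sq {X U F D : ℝ} (hU : 0 ≤ U) (hF : 0 ≤ F) (hD : 1 ≤ D)
    (h : X ^ 2 ≤ D * (F * X + U ^ 2)) : X ≤ D * (U + F) := by
  by_contra! hlt
  have hUX : U ≤ X := by nlinarith
  have h1 : U ^ 2 ≤ U * X := by nlinarith
  have h2 : D * (U + F) * X < X * X := mul_lt_mul_of_pos_right hlt (by nlinarith)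
  nlinarith

/-- The abstract energy estimate: the energy norm is bounded linearly by the data. -/
theorem IsPiecewiseAffine.energyNorm_le {L : X →L[ℝ] Y} {G : X →L[ℝ] Z} {C : ℝ} (hC1 : 1 ≤ C)
    (hC : ∀ v, ‖v‖ ^ 2 ≤ C * ‖G v‖ ^ 2) (hT : 0 < T) {P : TimePartition T} {a b : ℕ → X}
    {u : ℝ → X} (hu : IsPiecewiseAffine P a b u) {ν : ℝ} (hν : 0 < ν)
    {f f₂ : ℝ → StrongDual ℝ X} {f₁ : ℝ → Y}
    (hf₁ : MemLp f₁ 1 (timeMeasure T)) (hf₂ : MemLp f₂ 2 (timeMeasure T))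
    (hf : f =ᵐ[timeMeasure T] fun s => (innerSL ℝ (f₁ s)).comp L + f₂ s) {u₀ : Y}
    (heq : ∀ k ≤ P.N, dgForm P ν L G u (cutoff u (P.t k))
      = (∫ s in Ioc 0 T, f s (cutoff u (P.t k) s))
        + ⟪u₀, L (Function.rightLim (cutoff u (P.t k)) 0)⟫_ℝ) :
    eLpNorm (fun s => L (u s)) ∞ (timeMeasure T)
      + ENNReal.ofReal √ν * eLpNorm u 2 (timeMeasure T)
      ≤ ENNReal.ofReal (2 * (8 + C)) * (‖u₀‖ₑ
        + (eLpNorm f₁ 1 (timeMeasure T)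
          + ENNReal.ofReal (1 / √ν) * eLpNorm f₂ 2 (timeMeasure T))) := by
  have hu2 : MemLp u 2 (timeMeasure T) := hu.memLp 2
  have huL : MemLp (fun s => L (u s)) ∞ (timeMeasure T) :=
    L.comp_memLp' (hu.memLp ∞)
  have hug : MemLp (fun s => G (u s)) 2 (timeMeasure T) := G.comp_memLp' hu2
  obtain ⟨hsup, hgrad⟩ := hu.energy_le hT hν L G (u₀ := u₀) fun k hk => by
    rw [heq k hk]
    exact add_le_add_left (integral_apply_cutoff_le L hf₁ hf₂ hf hu2 huL _) _
  have hK : (eLpNorm u 2 (timeMeasure T)).toReal ^ 2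
      ≤ C * ∫ s in Ioc 0 T, ‖G (u s)‖ ^ 2 := by
    rw [MemLp.toReal_eLpNorm_two_sq hu2, ← integral_const_mul]
    exact integral_mono hu2.integrable_norm_pow' (hug.integrable_norm_pow'.const_mul C)
      fun s => hC (u s)
  set F₁ := (eLpNorm f₁ 1 (timeMeasure T)).toReal with hF₁
  set F₂ := (eLpNorm f₂ 2 (timeMeasure T)).toReal with hF₂
  set A := (eLpNorm (fun s => L (u s)) ∞ (timeMeasure T)).toReal with hA
  set K := (eLpNorm u 2 (timeMeasure T)).toReal with hKdef
  set Q := F₁ * A + F₂ * K + ‖u₀‖ ^ 2 with hQ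
  have hF₁0 : 0 ≤ F₁ := ENNReal.toReal_nonneg
  have hF₂0 : 0 ≤ F₂ := ENNReal.toReal_nonneg
  have hA0 : 0 ≤ A := ENNReal.toReal_nonneg
  have hK0 : 0 ≤ K := ENNReal.toReal_nonneg
  have hQ0 : 0 ≤ Q := by positivity
  have hAQ : A ^ 2 ≤ 8 * Q := by
    refine (Real.le_sqrt hA0 (by positivity)).1 (ENNReal.toReal_le_of_le_ofReal (by positivity) ?_)
    rw [eLpNorm_exponent_top]
    refine eLpNormEssSup_le_of_ae_bound ?_
    exact (ae_restrict_mem measurableSet_Ioc).mono fun s hs => Real.le_sqrt_of_sq_le (hsup s hs)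
  have hν' : √ν ^ 2 = ν := Real.sq_sqrt hν.le
  have hsν : 0 < √ν := Real.sqrt_pos.2 hν
  have hKQ : (√ν * K) ^ 2 ≤ C * Q := by
    rw [mul_pow, hν']
    calc ν * K ^ 2 ≤ ν * (C * ∫ s in Ioc 0 T, ‖G (u s)‖ ^ 2) := by gcongr
      _ = C * (ν * ∫ s in Ioc 0 T, ‖G (u s)‖ ^ 2) := by ring
      _ ≤ C * Q := by gcongr
  have hmain : A + √ν * K ≤ 2 * (8 + C) * (‖u₀‖ + (F₁ + 1 / √ν * F₂)) := by
    refine le_of_sq_le_mul_add_sq (norm_nonneg _) (by positivity) (by linarith) ?_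
    -- The weight `1 / √ν` is chosen so that `F₂ * K` is the product of `F₂ / √ν` and `√ν * K`; the
    -- cross terms are nonnegative.
    have hQle : Q ≤ (F₁ + 1 / √ν * F₂) * (A + √ν * K) + ‖u₀‖ ^ 2 := by
      have hexp : (F₁ + 1 / √ν * F₂) * (A + √ν * K)
          = F₁ * A + F₂ * K + (F₁ * (√ν * K) + 1 / √ν * F₂ * A) := by
        field_simp
        ring
      have h0 : 0 ≤ F₁ * (√ν * K) + 1 / √ν * F₂ * A := by positivity
      linarith
    -- The `8` comes from the nodal bounds, `C` from Poincaré, and `2` from squaring the sum.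
    calc (A + √ν * K) ^ 2 ≤ 2 * (A ^ 2 + (√ν * K) ^ 2) := add_sq_le
      _ ≤ 2 * (8 + C) * Q := by linarith
      _ ≤ _ := by gcongr
  have hE : eLpNorm (fun s => L (u s)) ∞ (timeMeasure T)
      + ENNReal.ofReal √ν * eLpNorm u 2 (timeMeasure T) = ENNReal.ofReal (A + √ν * K) := by
    rw [ENNReal.ofReal_add hA0 (by positivity), ENNReal.ofReal_mul hsν.le, hA, hKdef,
      ENNReal.ofReal_toReal huL.eLpNorm_ne_top, ENNReal.ofReal_toReal hu2.eLpNorm_ne_top]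
  rw [hE]
  refine (ENNReal.ofReal_le_ofReal hmain).trans_eq ?_
  rw [ENNReal.ofReal_mul (p := 2 * (8 + C)) (by positivity), ENNReal.ofReal_add (norm_nonneg _) (by positivity),
    ENNReal.ofReal_add hF₁0 (by positivity), ENNReal.ofReal_mul (p := 1 / √ν) (by positivity), ofReal_norm,
    hF₁, hF₂, ENNReal.ofReal_toReal hf₁.eLpNorm_ne_top,
    ENNReal.ofReal_toReal hf₂.eLpNorm_ne_top]

/-- The abstract energy estimate for a force given by an integrable function with values in the
pivot space. -/
theorem IsPiecewiseAffine.energyNorm_le_of_memLp_one {L : X →L[ℝ] Y} {G : X →L[ℝ] Z} {C : ℝ}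
    (hC1 : 1 ≤ C) (hC : ∀ v, ‖v‖ ^ 2 ≤ C * ‖G v‖ ^ 2) (hT : 0 < T) {P : TimePartition T}
    {a b : ℕ → X} {u : ℝ → X} (hu : IsPiecewiseAffine P a b u) {ν : ℝ} (hν : 0 < ν)
    {f : ℝ → Y} (hf : MemLp f 1 (timeMeasure T)) {u₀ : Y}
    (heq : ∀ k ≤ P.N, dgForm P ν L G u (cutoff u (P.t k))
      = (∫ s in Ioc 0 T, ((innerSL ℝ (f s)).comp L) (cutoff u (P.t k) s))
        + ⟪u₀, L (Function.rightLim (cutoff u (P.t k)) 0)⟫_ℝ) :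
    eLpNorm (fun s => L (u s)) ∞ (timeMeasure T)
      + ENNReal.ofReal √ν * eLpNorm u 2 (timeMeasure T)
      ≤ ENNReal.ofReal (2 * (8 + C)) * (‖u₀‖ₑ + eLpNorm f 1 (timeMeasure T)) := by
  have h := hu.energyNorm_le hC1 hC hT hν (f := fun s => (innerSL ℝ (f s)).comp L) hf
    (MemLp.zero (ε := StrongDual ℝ X)) (Eventually.of_forall fun s => (add_zero _).symm) heq
  rwa [eLpNorm_zero, mul_zero, add_zero] at h

end Abstract

/-- The energy norm is bounded linearly by the data of any splitting of the force. -/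
theorem IsDiscreteSolution.energyNorm_le {Ω : Set Plane} {C : ℝ} (hC1 : 1 ≤ C)
    (hC : ∀ v : H10 Ω, ‖v‖ ^ 2 ≤ C * ‖grad Ω v‖ ^ 2) {T : ℝ} (hT : 0 < T) {D : DiscretePair Ω}
    {P : TimePartition T} {q : ℕ} (hq : q = 0 ∨ q = 1) {ν : ℝ} (hν : 0 < ν) {f : ℝ → Hm1 Ω}
    {f₁ : ℝ → L2V Ω} {f₂ : ℝ → Hm1 Ω} (hf : IsSplitting T f f₁ f₂)
    {u₀ : L2V Ω} {u : ℝ → H10 Ω} (h : IsDiscreteSolution D P q ν f u₀ u) :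
    energyNorm T ν u ≤ ENNReal.ofReal (2 * (8 + C)) * (‖u₀‖ₑ
      + (eLpNorm f₁ 1 (timeMeasure T)
        + ENNReal.ofReal (1 / √ν) * eLpNorm f₂ 2 (timeMeasure T))) := by
  obtain ⟨a, b, hu⟩ := h.isDG.exists_isPiecewiseAffine hq
  exact hu.energyNorm_le hC1 hC hT hν hf.left hf.right hf.sum_eq fun k hk => h.dgForm_cutoff hk

/-- A linear bound that holds for all splittings holds for the norm of the sum space. -/
theorem le_mul_add_sumNorm {Ω : Set Plane} {T : ℝ} {f : ℝ → Hm1 Ω} {E x : ℝ≥0∞} {C : ℝ≥0}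
    (hC : C ≠ 0) (h : ∀ f₁ f₂, IsSplitting T f f₁ f₂ →
      E ≤ C * (x + (eLpNorm f₁ 1 (timeMeasure T) + eLpNorm f₂ 2 (timeMeasure T)))) :
    E ≤ C * (x + sumNorm T f) := by
  have hC0 : (C : ℝ≥0∞) ≠ 0 := by simpa using hC
  -- Dividing by `C` and subtracting `x` isolates `sumNorm`, so that the bound can be checked under
  -- the infimum. Truncated subtraction makes finiteness of `x` unnecessary.
  rw [← ENNReal.div_le_iff' hC0 ENNReal.coe_ne_top, ← tsub_le_iff_left, sumNorm]
  refine le_iInf fun f₁ => le_iInf fun f₂ => le_iInf fun hf => ?_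
  rw [tsub_le_iff_left, ENNReal.div_le_iff' hC0 ENNReal.coe_ne_top]
  exact h f₁ f₂ hf

end NavierStokesDG

theorem mainTheorem7 (Ω : Set Plane) (hΩ : IsConvexPolygonalDomain Ω) :
    (∀ ν : ℝ, 0 < ν → ∃ C : ℝ≥0, ∀ (T : ℝ), 0 < T →
      ∀ (P : TimePartition T) (D : DiscretePair Ω) (q : ℕ), (q = 0 ∨ q = 1) →
      ∀ (f : ℝ → Hm1 Ω), MemSum T f →
      ∀ u₀ ∈ solenoidal Ω, ∀ u : ℝ → H10 Ω, IsDiscreteSolution D P q ν f u₀ u →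
        energyNorm T ν u ≤ C * (‖u₀‖ₑ + sumNorm T f)) ∧
    (∃ C : ℝ≥0, ∀ ν : ℝ, 0 < ν → ∀ (T : ℝ), 0 < T →
      ∀ (P : TimePartition T) (D : DiscretePair Ω) (q : ℕ), (q = 0 ∨ q = 1) →
      ∀ (f : ℝ → L2V Ω), MemLp f 1 (timeMeasure T) →
      ∀ u₀ ∈ solenoidal Ω, ∀ u : ℝ → H10 Ω,
        IsDiscreteSolution D P q ν (fun s => toHm1 (f s)) u₀ u →
        energyNorm T ν u ≤ C * (‖u₀‖ₑ + eLpNorm f 1 (timeMeasure T))) := by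
  obtain ⟨C, hC1, hC⟩ := exists_norm_sq_le hΩ.isBounded
  refine ⟨fun ν hν => ?_, (2 * (8 + C)).toNNReal, ?_⟩
  -- The factor `1 + 1 / √ν` dominates both the weight `1` of `u₀` and `f₁` and the weight `1 / √ν`
  -- of `f₂`.
  · refine ⟨(2 * (8 + C)).toNNReal * (1 + (1 / √ν).toNNReal), ?_⟩
    intro T hT P D q hq f _ u₀ _ u hu
    have hpos : (2 * (8 + C)).toNNReal ≠ 0 := (Real.toNNReal_pos.2 (by linarith)).ne'
    refine le_mul_add_sumNorm (mul_ne_zero hpos (by positivity)) fun f₁ f₂ hf => ?_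
    refine (hu.energyNorm_le hC1 hC hT hq hν hf).trans ?_
    rw [ENNReal.coe_mul, mul_assoc, ENNReal.coe_add, ENNReal.coe_one]
    change _ ≤ ENNReal.ofReal (2 * (8 + C)) * ((1 + ENNReal.ofReal (1 / √ν)) * _)
    gcongr
    rw [mul_add, mul_add]
    gcongr
    · exact le_mul_of_one_le_left' le_self_add
    · exact le_mul_of_one_le_left' le_self_add
    · exact le_add_self
  · intro ν hν T hT P D q hq f hf u₀ _ u hu
    obtain ⟨a, b, hab⟩ := hu.isDG.exists_isPiecewiseAffine hq
    exact hab.energyNorm_le_of_memLp_one hC1 hC hT hν hf fun k hk => hu.dgForm_cutoff hk
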